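/- **Theorem.** Let $n\ge 2$ be fixed, and for every $m\in\mathbb N$ let $p=p(m)\in\mathbb N$, where $p\to\infty$ and $m/p\to c\in(0,\infty)$ as $m\to\infty$. Let $\mathbf A_m$ be deterministic real $m\times p$ matrices with non-negative entries such that $\frac1{mp}\operatorname{tr}(\mathbf A_m\mathbf A_m^\top)$ is bounded uniformly in $m$, and let $\mathbf\Sigma_m$ be deterministic symmetric positive semidefinite $m\times m$ matrices such that $\frac1m\operatorname{tr}(\mathbf\Sigma_m)$ is bounded uniformly in $m$; write $\mathbf\Sigma_m^{1/2}$ for the symmetric positive semidefinite square root of $\mathbf\Sigma_m$. On one probability space, let $\mathbf E_m^1,\dots,\mathbf E_m^n$ be random $m\times p$ matrices such that for each $m$ all the entries of these $n$ matrices together are i.i.d. with mean $0$ and variance $1$, and such that for some $\varepsilon>0$ their absolute moments of order $4+\varepsilon$ are finite and bounded uniformly in $m$ (for instance, because the law of the entries does not depend on $m$). Nothing is assumed about the joint law of the noise matrices for different $m$. Put $$\tilde{\mathbf A}_m^k=\mathbf A_m+\mathbf\Sigma_m^{1/2}\mathbf E_m^k\quad(k=1,\dots,n),\qquad \bar{\mathbf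 A}_m=\frac1n\sum_{k=1}^n\tilde{\mathbf A}_m^k,$$ and let $\mathbf U_m$ be the $m\times p$ matrix all of whose entries are $1$. Then, almost surely, as $m\to\infty$, $$\Big|\tfrac1{mp}\operatorname{tr}(\bar{\mathbf A}_m\mathbf U_m^\top)-\tfrac1{mp}\operatorname{tr}(\mathbf A_m\mathbf U_m^\top)\Big|\to0,$$ $$\Big|\tfrac1{mp}\operatorname{tr}(\bar{\mathbf A}_m\mathbf A_m^\top)-\tfrac1{mp}\operatorname{tr}(\mathbf A_m\mathbf A_m^\top)\Big|\to0,$$ $$\Big|\tfrac1{mp}\operatorname{tr}(\bar{\mathbf A}_m\bar{\mathbf A}_m^\top)-\tfrac1{mp}\operatorname{tr}(\mathbf A_m\mathbf A_m^\top)-\tfrac1{nm}\operatorname{tr}(\mathbf\Sigma_m)\Big|\to0.$$ -/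

import Mathlib

open MeasureTheory ProbabilityTheory Filter Topology

noncomputable section

namespace ColumnCorrelated

open scoped MatrixOrder in
/-- The symmetric positive semidefinite square root of a positive semidefinite real matrix. -/
def matSqrt {m : ℕ} (S : Matrix (Fin m) (Fin m) ℝ) : Matrix (Fin m) (Fin m) ℝ :=
  CFC.sqrt S

/-- The `m × p` target matrix all of whose entries are one. -/
def allOnes (m p : ℕ) : Matrix (Fin m) (Fin p) ℝ :=
  Matrix.of fun _ _ => 1

/-- An observation of `A` under column-correlated noise: `A + S ^ (1/2) * E`. -/
def observation {m p : ℕ} (A : Matrix (Fin m) (Fin p) ℝ) (S : Matrix (Fin m) (Fin m) ℝ)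
    (E : Matrix (Fin m) (Fin p) ℝ) : Matrix (Fin m) (Fin p) ℝ :=
  A + matSqrt S * E

/-- The average of the `n` observations of `A` with noise matrices `E 0, …, E (n - 1)`. -/
def sampleMean {n m p : ℕ} (A : Matrix (Fin m) (Fin p) ℝ) (S : Matrix (Fin m) (Fin m) ℝ)
    (E : Fin n → Matrix (Fin m) (Fin p) ℝ) : Matrix (Fin m) (Fin p) ℝ :=
  (1 / (n : ℝ)) • ∑ k, observation A S (E k)

/-- The deterministic sequence `x` is an asymptotic deterministic equivalent of the sequence of
random variables `X`: `|X m - x m| → 0` almost surely as `m → ∞`. -/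
def AsympDetEquiv {Ω : Type*} [MeasurableSpace Ω] (P : Measure Ω)
    (X : ℕ → Ω → ℝ) (x : ℕ → ℝ) : Prop :=
  ∀ᵐ ω ∂P, Tendsto (fun m => |X m ω - x m|) atTop (𝓝 0)

/-- The entries of the `n` random `m × p` matrices `E 0, …, E (n - 1)` are altogether independent
and identically distributed, with mean zero and variance one. -/
structure IsStandardNoise {Ω : Type*} [MeasurableSpace Ω] (P : Measure Ω) {n m p : ℕ}
    (E : Fin n → Ω → Matrix (Fin m) (Fin p) ℝ) : Prop where
  measurable : ∀ k i j, Measurable fun ω => E k ω i j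
  indep : iIndepFun (fun (t : Fin n × Fin m × Fin p) ω => E t.1 ω t.2.1 t.2.2) P
  identDistrib : ∀ k i j k' i' j',
    IdentDistrib (fun ω => E k ω i j) (fun ω => E k' ω i' j') P P
  mean : ∀ k i j, ∫ ω, E k ω i j ∂P = 0
  variance : ∀ k i j, Var[fun ω => E k ω i j; P] = 1

end ColumnCorrelated

end

/-!
The noise of the sample mean is `G * X`, where `X` stacks the `n` noise matrices on top of each
other and `G` is the row of `n` blocks `S ^ (1/2) / n`, so that `tr (G Gᵀ) = tr S / n`. Everything
therefore reduces to the statistics `tr (G X Mᵀ)` and `tr (G X (G X)ᵀ)` of one white noise matrix.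

A sum of independent centred variables satisfies the Marcinkiewicz–Zygmund type bound
`‖∑ Xᵢ‖_r² ≤ C_r ∑ ‖Xᵢ‖_r²` for `r ≥ 2`. Normalised by `m p`, the linear statistic has squared
`L^r` norm `O(1/p)`. The quadratic one is a sum over the `p` independent columns of `X`; its
summands have mean `tr (G Gᵀ)` and `L^(r/2)` norm `O(tr (G Gᵀ))`, so after centring and normalising
its squared `L^(r/2)` norm is `O(1/p)` as well. As `p` grows at least linearly in `m` and
`r / 2 > 2`, the moments of order `r` and `r / 2` are summable over `m`, and almost sure convergence
follows whatever the joint law of the noise for different `m`.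
-/

namespace ColumnCorrelated

section ScalarInequalities

lemma abs_one_add_rpow_le {r : ℝ} (hr : 2 ≤ r) (z : ℝ) :
    |1 + z| ^ r ≤ 1 + r * z + (r + 1) ^ r * (z ^ 2 + |z| ^ r) := by
  have hC : r ^ 2 ≤ (r + 1) ^ r := by
    calc r ^ 2 ≤ (r + 1) ^ 2 := by gcongr; linarith
      _ = (r + 1) ^ (2 : ℝ) := by norm_cast
      _ ≤ (r + 1) ^ r := Real.rpow_le_rpow_of_exponent_le (by linarith) hr
  have hCz : r ^ 2 * z ^ 2 ≤ (r + 1) ^ r * z ^ 2 := by gcongr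
  have hC0 : 0 ≤ (r + 1) ^ r := by positivity
  rcases le_or_gt |r * z| 1 with hsmall | hlarge
  · have hz : |z| ≤ 1 := by
      rw [abs_mul, abs_of_pos (by linarith)] at hsmall
      nlinarith [abs_nonneg z]
    have hz0 : 0 ≤ 1 + z := by linarith [(abs_le.1 hz).1]
    have hexp : |1 + z| ^ r ≤ Real.exp (r * z) := by
      rw [abs_of_nonneg hz0, mul_comm r z, Real.exp_mul]
      exact Real.rpow_le_rpow hz0 (by linarith [Real.add_one_le_exp z]) (by linarith)
    have htaylor : Real.exp (r * z) - 1 - r * z ≤ (r * z) ^ 2 :=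
      (abs_le.1 (Real.abs_exp_sub_one_sub_id_le hsmall)).2
    nlinarith [mul_nonneg hC0 (Real.rpow_nonneg (abs_nonneg z) r)]
  · have hbase : |1 + z| ≤ (r + 1) * |z| := by
      rw [abs_mul, abs_of_pos (by linarith)] at hlarge
      linarith [abs_add_le 1 z, abs_one (α := ℝ)]
    have hpow : |1 + z| ^ r ≤ (r + 1) ^ r * |z| ^ r := by
      rw [← Real.mul_rpow (by linarith) (abs_nonneg z)]
      exact Real.rpow_le_rpow (abs_nonneg _) hbase (by linarith)
    have hlin : |r * z| ≤ r ^ 2 * z ^ 2 := by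
      rw [← mul_pow, ← sq_abs]; nlinarith
    linarith [neg_abs_le (r * z)]

lemma abs_add_rpow_le {r : ℝ} (hr : 2 ≤ r) (x y : ℝ) :
    |x + y| ^ r ≤ |x| ^ r + r * (|x| ^ (r - 2) * x * y) +
      (r + 1) ^ r * (|x| ^ (r - 2) * y ^ 2 + |y| ^ r) := by
  rcases eq_or_ne x 0 with rfl | hx
  · have hC : (1 : ℝ) ≤ (r + 1) ^ r := Real.one_le_rpow (by linarith) (by linarith)
    have hy : 0 ≤ |y| ^ r := by positivity
    have hxy : 0 ≤ |(0 : ℝ)| ^ (r - 2) * y ^ 2 := by positivity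
    rw [zero_add, abs_zero, Real.zero_rpow (by linarith)]
    rw [abs_zero] at hxy
    nlinarith
  · have hx' : 0 < |x| := abs_pos.2 hx
    have scale (z : ℝ) : |x| ^ r * |z| ^ r = |x * z| ^ r := by
      rw [← Real.mul_rpow hx'.le (abs_nonneg _), ← abs_mul]
    have split : |x| ^ r = |x| ^ (r - 2) * x ^ 2 := by
      rw [← sq_abs x, ← Real.rpow_natCast, ← Real.rpow_add hx']; norm_num
    calc |x + y| ^ r = |x| ^ r * |1 + y / x| ^ r := by
          rw [scale, mul_add, mul_one, mul_div_cancel₀ _ hx]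
      _ ≤ |x| ^ r * (1 + r * (y / x) + (r + 1) ^ r * ((y / x) ^ 2 + |y / x| ^ r)) := by
          gcongr
          exact abs_one_add_rpow_le hr (y / x)
      _ = |x| ^ r + r * (|x| ^ r * (y / x)) +
          (r + 1) ^ r * (|x| ^ r * (y / x) ^ 2 + |x| ^ r * |y / x| ^ r) := by ring
      _ = |x| ^ r + r * (|x| ^ (r - 2) * x * y) +
          (r + 1) ^ r * (|x| ^ (r - 2) * y ^ 2 + |y| ^ r) := by
          rw [scale, mul_div_cancel₀ _ hx, split]
          field_simp

-- Read `ρ = r / 2`, `s = ‖X‖_r²` and `t = ‖Y‖_r²`: this turns a bound on `‖X + Y‖_r ^ r` into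
-- one on `‖X + Y‖_r²` that iterates along a sum without the constant growing.
lemma rpow_add_mul_le_add_rpow {ρ C s t : ℝ} (hρ : 1 ≤ ρ) (hC : 1 ≤ C) (hs : 0 ≤ s)
    (ht : 0 ≤ t) :
    s ^ ρ + C * (s ^ (ρ - 1) * t + t ^ ρ) ≤ (s + 2 * C * t) ^ ρ := by
  have rpow_eq {u : ℝ} (hu : 0 ≤ u) : u ^ ρ = u ^ (ρ - 1) * u := by
    rw [← Real.rpow_add_one' hu (by linarith), sub_add_cancel]
  have hCt : 0 ≤ C * t := by positivity
  have hs_le : s ^ (ρ - 1) ≤ (s + 2 * C * t) ^ (ρ - 1) :=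
    Real.rpow_le_rpow hs (by linarith) (by linarith)
  have ht_le : t ^ (ρ - 1) ≤ (s + 2 * C * t) ^ (ρ - 1) :=
    Real.rpow_le_rpow ht (by nlinarith) (by linarith)
  calc s ^ ρ + C * (s ^ (ρ - 1) * t + t ^ ρ)
      = s ^ (ρ - 1) * s + s ^ (ρ - 1) * (C * t) + t ^ (ρ - 1) * (C * t) := by
        rw [rpow_eq hs, rpow_eq ht]; ring
    _ ≤ (s + 2 * C * t) ^ (ρ - 1) * s + (s + 2 * C * t) ^ (ρ - 1) * (C * t) +
          (s + 2 * C * t) ^ (ρ - 1) * (C * t) := by gcongr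
    _ = (s + 2 * C * t) ^ ρ := by rw [rpow_eq (by positivity)]; ring

end ScalarInequalities

variable {Ω : Type*} [MeasurableSpace Ω] {P : Measure Ω} {X Y : Ω → ℝ} {r : ℝ}

section LpNorm

lemma integral_abs_rpow_eq_lpNorm_rpow (hr : 0 < r) (hX : AEStronglyMeasurable X P) :
    ∫ ω, |X ω| ^ r ∂P = lpNorm X (ENNReal.ofReal r) P ^ r := by
  rw [lpNorm_eq_integral_norm_rpow_toReal (by simpa using hr) ENNReal.ofReal_ne_top hX,
    ENNReal.toReal_ofReal hr.le, Real.rpow_inv_rpow (by positivity) hr.ne']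
  rfl

lemma integrable_abs_rpow_iff (hr : 0 < r) (hX : AEStronglyMeasurable X P) :
    Integrable (fun ω => |X ω| ^ r) P ↔ MemLp X (ENNReal.ofReal r) P := by
  rw [← integrable_norm_rpow_iff hX (by simpa using hr) ENNReal.ofReal_ne_top,
    ENNReal.toReal_ofReal hr.le]
  rfl

lemma eLpNorm_sq (hr : 0 ≤ r) :
    eLpNorm (fun ω => X ω ^ 2) (ENNReal.ofReal (r / 2)) P =
      eLpNorm X (ENNReal.ofReal r) P ^ 2 := by
  have h := eLpNorm_norm_rpow (p := ENNReal.ofReal (r / 2)) (μ := P) X (q := 2) two_pos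
  rw [← ENNReal.ofReal_mul (by linarith), div_mul_cancel₀ _ two_ne_zero] at h
  simpa using h

lemma memLp_sq (hr : 0 ≤ r) (hX : MemLp X (ENNReal.ofReal r) P) :
    MemLp (fun ω => X ω ^ 2) (ENNReal.ofReal (r / 2)) P :=
  ⟨hX.1.pow 2, by rw [eLpNorm_sq hr]; exact ENNReal.pow_lt_top hX.2⟩

lemma lpNorm_sq (hr : 0 ≤ r) (hX : AEStronglyMeasurable X P) :
    lpNorm (fun ω => X ω ^ 2) (ENNReal.ofReal (r / 2)) P =
      lpNorm X (ENNReal.ofReal r) P ^ 2 := by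
  rw [← toReal_eLpNorm hX, ← toReal_eLpNorm (f := fun ω => X ω ^ 2) (hX.pow 2), eLpNorm_sq hr,
    ENNReal.toReal_pow]

variable [IsProbabilityMeasure P]

lemma lpNorm_le_lpNorm_of_exponent_le {p q : ENNReal} (hpq : p ≤ q) (hX : MemLp X q P) :
    lpNorm X p P ≤ lpNorm X q P := by
  rw [← toReal_eLpNorm hX.1, ← toReal_eLpNorm hX.1]
  exact ENNReal.toReal_mono hX.eLpNorm_ne_top (eLpNorm_le_eLpNorm_of_exponent_le hpq hX.1)

lemma lpNorm_sub_integral_le {q : ENNReal} (hq : 1 ≤ q) (hX : MemLp X q P) :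
    lpNorm (fun ω => X ω - ∫ ω, X ω ∂P) q P ≤ 2 * lpNorm X q P := by
  have hmean : |∫ ω, X ω ∂P| ≤ lpNorm X q P :=
    calc |∫ ω, X ω ∂P| ≤ ∫ ω, |X ω| ∂P := abs_integral_le_integral_abs
      _ = lpNorm X 1 P := (lpNorm_one_eq_integral_norm hX.1).symm
      _ ≤ lpNorm X q P := lpNorm_le_lpNorm_of_exponent_le hq hX
  calc lpNorm (fun ω => X ω - ∫ ω, X ω ∂P) q P
      ≤ lpNorm X q P + lpNorm (fun _ => ∫ ω, X ω ∂P) q P := lpNorm_sub_le hX hq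
    _ ≤ 2 * lpNorm X q P := by
      rw [lpNorm_const (by positivity) (NeZero.ne P)]
      simpa [two_mul] using hmean

end LpNorm

section MarcinkiewiczZygmund

/-- The constant in the Marcinkiewicz–Zygmund inequality `lpNorm_sum_sq_le` for the exponent `r`.
It is explicit but not sharp. -/
noncomputable def mzConst (r : ℝ) : ℝ := 2 * (r + 1) ^ r

lemma mzConst_nonneg (hr : 0 ≤ r) : 0 ≤ mzConst r := by
  unfold mzConst; positivity

variable [IsProbabilityMeasure P]

lemma integrable_abs_rpow {a : ℝ} (ha : 0 ≤ a) (har : a ≤ r)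
    (hX : MemLp X (ENNReal.ofReal r) P) : Integrable (fun ω => |X ω| ^ a) P := by
  have h := (hX.mono_exponent (ENNReal.ofReal_le_ofReal har)).integrable_norm_rpow'
  simpa only [Real.norm_eq_abs, ENNReal.toReal_ofReal ha] using h

lemma integral_abs_rpow_le {a : ℝ} (ha : 0 ≤ a) (har : a ≤ r)
    (hX : MemLp X (ENNReal.ofReal r) P) :
    ∫ ω, |X ω| ^ a ∂P ≤ lpNorm X (ENNReal.ofReal r) P ^ a := by
  rcases ha.eq_or_lt with rfl | ha
  · simp
  · rw [integral_abs_rpow_eq_lpNorm_rpow ha hX.1]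
    exact Real.rpow_le_rpow lpNorm_nonneg
      (lpNorm_le_lpNorm_of_exponent_le (ENNReal.ofReal_le_ofReal har) hX) ha.le

lemma integrable_abs_rpow_mul_self {a : ℝ} (ha : 0 ≤ a) (har : a + 1 ≤ r)
    (hX : MemLp X (ENNReal.ofReal r) P) : Integrable (fun ω => |X ω| ^ a * X ω) P := by
  refine (integrable_abs_rpow (by linarith) har hX).mono
    ((integrable_abs_rpow ha (by linarith) hX).1.mul hX.1) (.of_forall fun ω => le_of_eq ?_)
  rw [norm_mul, Real.norm_eq_abs (X ω), Real.norm_of_nonneg (by positivity),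
    Real.norm_of_nonneg (by positivity), Real.rpow_add_one' (abs_nonneg _) (by linarith)]

lemma integrable_abs_rpow_mul_self_mul_and_integral_eq_zero (hr : 2 ≤ r)
    (hX : MemLp X (ENNReal.ofReal r) P) (hY : Integrable Y P) (hXY : IndepFun X Y P)
    (hY0 : ∫ ω, Y ω ∂P = 0) :
    Integrable (fun ω => |X ω| ^ (r - 2) * X ω * Y ω) P ∧
      ∫ ω, |X ω| ^ (r - 2) * X ω * Y ω ∂P = 0 := by
  have hX' := integrable_abs_rpow_mul_self (a := r - 2) (by linarith) (by linarith) hX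
  have hindep : IndepFun (fun ω => |X ω| ^ (r - 2) * X ω) Y P :=
    hXY.comp (φ := fun x : ℝ => |x| ^ (r - 2) * x) (ψ := id) (by fun_prop) measurable_id
  exact ⟨hindep.integrable_mul hX' hY, by
    rw [hindep.integral_fun_mul_eq_mul_integral hX'.1 hY.1, hY0, mul_zero]⟩

lemma integrable_abs_rpow_mul_sq_and_integral_le (hr : 2 ≤ r)
    (hX : MemLp X (ENNReal.ofReal r) P) (hY : MemLp Y (ENNReal.ofReal r) P)
    (hXY : IndepFun X Y P) :
    Integrable (fun ω => |X ω| ^ (r - 2) * Y ω ^ 2) P ∧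
      ∫ ω, |X ω| ^ (r - 2) * Y ω ^ 2 ∂P ≤
        lpNorm X (ENNReal.ofReal r) P ^ (r - 2) * lpNorm Y (ENNReal.ofReal r) P ^ 2 := by
  have hX' := integrable_abs_rpow (a := r - 2) (by linarith) (by linarith) hX
  have hY' : Integrable (fun ω => Y ω ^ 2) P := by
    simpa using integrable_abs_rpow (a := 2) zero_le_two hr hY
  have hindep : IndepFun (fun ω => |X ω| ^ (r - 2)) (fun ω => Y ω ^ 2) P :=
    hXY.comp (φ := fun x : ℝ => |x| ^ (r - 2)) (ψ := fun y : ℝ => y ^ 2) (by fun_prop)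
      (by fun_prop)
  refine ⟨hindep.integrable_mul hX' hY', ?_⟩
  rw [hindep.integral_fun_mul_eq_mul_integral hX'.1 hY'.1]
  refine mul_le_mul (integral_abs_rpow_le (by linarith) (by linarith) hX) ?_ (by positivity)
    (Real.rpow_nonneg lpNorm_nonneg _)
  simpa using integral_abs_rpow_le (a := 2) zero_le_two hr hY

lemma integral_abs_add_rpow_le (hr : 2 ≤ r) (hX : MemLp X (ENNReal.ofReal r) P)
    (hY : MemLp Y (ENNReal.ofReal r) P) (hXY : IndepFun X Y P) (hY0 : ∫ ω, Y ω ∂P = 0) :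
    ∫ ω, |X ω + Y ω| ^ r ∂P ≤ lpNorm X (ENNReal.ofReal r) P ^ r +
      (r + 1) ^ r * (lpNorm X (ENNReal.ofReal r) P ^ (r - 2) *
        lpNorm Y (ENNReal.ofReal r) P ^ 2 + lpNorm Y (ENNReal.ofReal r) P ^ r) := by
  have hr0 : 0 < r := by linarith
  have iX := (integrable_abs_rpow_iff hr0 hX.1).2 hX
  have iY := (integrable_abs_rpow_iff hr0 hY.1).2 hY
  obtain ⟨i_cross, cross_eq⟩ := integrable_abs_rpow_mul_self_mul_and_integral_eq_zero hr hX
    (hY.integrable (by simpa using by linarith)) hXY hY0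
  obtain ⟨i_sq, sq_le⟩ := integrable_abs_rpow_mul_sq_and_integral_le hr hX hY hXY
  have i_left : Integrable (fun ω => |X ω| ^ r + r * (|X ω| ^ (r - 2) * X ω * Y ω)) P :=
    iX.add (i_cross.const_mul r)
  have i_right : Integrable (fun ω => (r + 1) ^ r * (|X ω| ^ (r - 2) * Y ω ^ 2 + |Y ω| ^ r)) P :=
    (i_sq.add iY).const_mul _
  calc ∫ ω, |X ω + Y ω| ^ r ∂P
      ≤ ∫ ω, (|X ω| ^ r + r * (|X ω| ^ (r - 2) * X ω * Y ω) +
          (r + 1) ^ r * (|X ω| ^ (r - 2) * Y ω ^ 2 + |Y ω| ^ r)) ∂P :=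
        integral_mono ((integrable_abs_rpow_iff hr0 (hX.add hY).1).2 (hX.add hY))
          (i_left.add i_right) fun ω => abs_add_rpow_le hr _ _
    _ = ∫ ω, |X ω| ^ r ∂P + r * ∫ ω, |X ω| ^ (r - 2) * X ω * Y ω ∂P +
          (r + 1) ^ r * (∫ ω, |X ω| ^ (r - 2) * Y ω ^ 2 ∂P + ∫ ω, |Y ω| ^ r ∂P) := by
        rw [integral_add i_left i_right, integral_add iX (i_cross.const_mul r),
          integral_const_mul, integral_const_mul, integral_add i_sq iY]
    _ ≤ _ := by
        rw [cross_eq, mul_zero, add_zero, integral_abs_rpow_eq_lpNorm_rpow hr0 hX.1,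
          integral_abs_rpow_eq_lpNorm_rpow hr0 hY.1]
        gcongr

lemma lpNorm_add_sq_le (hr : 2 ≤ r) (hX : MemLp X (ENNReal.ofReal r) P)
    (hY : MemLp Y (ENNReal.ofReal r) P) (hXY : IndepFun X Y P) (hY0 : ∫ ω, Y ω ∂P = 0) :
    lpNorm (X + Y) (ENNReal.ofReal r) P ^ 2 ≤
      lpNorm X (ENNReal.ofReal r) P ^ 2 + mzConst r * lpNorm Y (ENNReal.ofReal r) P ^ 2 := by
  have rpow_eq {u : ℝ} (hu : 0 ≤ u) (a : ℝ) : u ^ a = (u ^ 2) ^ (a / 2) := by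
    rw [← Real.rpow_two, ← Real.rpow_mul hu, mul_div_cancel₀ _ two_ne_zero]
  have hC : (1 : ℝ) ≤ (r + 1) ^ r := Real.one_le_rpow (by linarith) (by linarith)
  have hC0 := mzConst_nonneg (r := r) (by linarith)
  rw [← Real.rpow_le_rpow_iff (z := r / 2) (by positivity) (by positivity) (by linarith)]
  calc (lpNorm (X + Y) (ENNReal.ofReal r) P ^ 2) ^ (r / 2)
      = ∫ ω, |X ω + Y ω| ^ r ∂P := by
        rw [← rpow_eq lpNorm_nonneg,
          ← integral_abs_rpow_eq_lpNorm_rpow (by linarith) (hX.add hY).1]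
        rfl
    _ ≤ _ := integral_abs_add_rpow_le hr hX hY hXY hY0
    _ ≤ _ := by
        simp only [rpow_eq lpNorm_nonneg r, rpow_eq lpNorm_nonneg (r - 2),
          show (r - 2) / 2 = r / 2 - 1 by ring]
        exact rpow_add_mul_le_add_rpow (by linarith) hC (sq_nonneg _) (sq_nonneg _)

theorem lpNorm_sum_sq_le {ι : Type*} {X : ι → Ω → ℝ} (hr : 2 ≤ r) (hind : iIndepFun X P)
    (hX : ∀ i, MemLp (X i) (ENNReal.ofReal r) P) (hX0 : ∀ i, ∫ ω, X i ω ∂P = 0) (s : Finset ι) :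
    lpNorm (∑ i ∈ s, X i) (ENNReal.ofReal r) P ^ 2 ≤
      mzConst r * ∑ i ∈ s, lpNorm (X i) (ENNReal.ofReal r) P ^ 2 := by
  classical
  induction s using Finset.induction_on with
  | empty => simp
  | insert i s hi ih =>
    have hindep : IndepFun (∑ j ∈ s, X j) (X i) P :=
      hind.indepFun_finsetSum_of_notMem₀ (fun j => (hX j).1.aemeasurable) hi
    calc lpNorm (∑ j ∈ insert i s, X j) (ENNReal.ofReal r) P ^ 2
        = lpNorm (∑ j ∈ s, X j + X i) (ENNReal.ofReal r) P ^ 2 := by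
          rw [Finset.sum_insert hi, add_comm]
      _ ≤ lpNorm (∑ j ∈ s, X j) (ENNReal.ofReal r) P ^ 2 +
            mzConst r * lpNorm (X i) (ENNReal.ofReal r) P ^ 2 :=
          lpNorm_add_sq_le hr (memLp_finsetSum' s fun j _ => hX j) (hX i) hindep (hX0 i)
      _ ≤ mzConst r * ∑ j ∈ insert i s, lpNorm (X j) (ENNReal.ofReal r) P ^ 2 := by
          rw [Finset.sum_insert hi, mul_add]
          linarith

end MarcinkiewiczZygmund

section Convergence

lemma ae_tendsto_zero_of_summable_integral {X : ℕ → Ω → ℝ} (hr : 0 < r)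
    (hX : ∀ m, MemLp (X m) (ENNReal.ofReal r) P)
    (hsum : Summable fun m => ∫ ω, |X m ω| ^ r ∂P) :
    ∀ᵐ ω ∂P, Tendsto (fun m => X m ω) atTop (𝓝 0) := by
  have hint (m : ℕ) : Integrable (fun ω => |X m ω| ^ r) P :=
    (integrable_abs_rpow_iff hr (hX m).1).2 (hX m)
  have hmeas (m : ℕ) : AEMeasurable (fun ω => ENNReal.ofReal (|X m ω| ^ r)) P :=
    (hint m).1.aemeasurable.ennreal_ofReal
  have hfin : ∫⁻ ω, ∑' m, ENNReal.ofReal (|X m ω| ^ r) ∂P ≠ ⊤ := by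
    rw [lintegral_tsum hmeas]
    simp_rw [← ofReal_integral_eq_lintegral_ofReal (hint _) (.of_forall fun _ =>
      Real.rpow_nonneg (abs_nonneg _) r)]
    exact hsum.tsum_ofReal_ne_top
  filter_upwards [ae_lt_top' (AEMeasurable.tsum hmeas) hfin] with ω hω
  have hrpow : Tendsto (fun m => |X m ω| ^ r) atTop (𝓝 0) := by
    refine ((ENNReal.tendsto_toReal ENNReal.zero_ne_top).comp
      (ENNReal.tendsto_atTop_zero_of_tsum_ne_top hω.ne)).congr fun m => ?_
    exact ENNReal.toReal_ofReal (by positivity)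
  have habs := hrpow.rpow_const (p := r⁻¹) (Or.inr (by positivity))
  rw [Real.zero_rpow (by positivity)] at habs
  rw [tendsto_zero_iff_abs_tendsto_zero]
  exact habs.congr fun m => Real.rpow_rpow_inv (abs_nonneg _) hr.ne'

theorem ae_tendsto_zero_of_isBigO_lpNorm_sq {X : ℕ → Ω → ℝ} (hr : 2 < r)
    (hX : ∀ m, MemLp (X m) (ENNReal.ofReal r) P)
    (hO : (fun m => lpNorm (X m) (ENNReal.ofReal r) P ^ 2) =O[atTop] fun m : ℕ => (m : ℝ)⁻¹) :
    ∀ᵐ ω ∂P, Tendsto (fun m => X m ω) atTop (𝓝 0) := by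
  refine ae_tendsto_zero_of_summable_integral (by linarith) hX ?_
  refine summable_of_isBigO_nat (Real.summable_nat_rpow_inv.2 (show 1 < r / 2 by linarith)) ?_
  have hpow := hO.rpow (r := r / 2) (by linarith) (.of_forall fun m => by positivity)
  refine hpow.congr (fun m => ?_) fun m => Real.inv_rpow m.cast_nonneg _
  rw [integral_abs_rpow_eq_lpNorm_rpow (by linarith) (hX m).1, ← Real.rpow_two,
    ← Real.rpow_mul lpNorm_nonneg, mul_div_cancel₀ _ two_ne_zero]

end Convergence

section Independence

lemma iIndepFun_curry {α β 𝓧 : Type*} [Countable α] [Countable β] [MeasurableSpace 𝓧]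
    {X : α × β → Ω → 𝓧} (hX : ∀ t, AEMeasurable (X t) P) (hind : iIndepFun X P) :
    iIndepFun (fun i ω j => X (i, j) ω) P := by
  have := hind.isProbabilityMeasure
  have hmarg : ∀ t, IsProbabilityMeasure (P.map (X t)) := fun t =>
    Measure.isProbabilityMeasure_map (hX t)
  have hrow : ∀ i, P.map (fun ω j => X (i, j) ω) =
      Measure.infinitePi fun j => P.map (X (i, j)) := fun i =>
    (hind.precomp (Prod.mk_right_injective i)).map_fun_eq_infinitePi_map₀' fun j => hX (i, j)
  have hcurry : (fun ω i j => X (i, j) ω) = MeasurableEquiv.curry α β 𝓧 ∘ fun ω t => X t ω := rfl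
  rw [iIndepFun_iff_map_fun_eq_infinitePi_map₀' fun i =>
      aemeasurable_pi_lambda _ fun j => hX (i, j), hcurry,
    ← AEMeasurable.map_map_of_aemeasurable (MeasurableEquiv.measurable _).aemeasurable
      (aemeasurable_pi_lambda _ hX), hind.map_fun_eq_infinitePi_map₀' hX]
  simp only [hrow]
  exact Measure.infinitePi_map_curry fun i j => P.map (X (i, j))

end Independence

section LinearForms

variable [IsProbabilityMeasure P] {ι : Type*} [Fintype ι] {Z : ι → Ω → ℝ}

lemma lpNorm_sum_mul_sq_le {r κ : ℝ} (hr : 2 ≤ r) (hind : iIndepFun Z P)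
    (hZ : ∀ i, MemLp (Z i) (ENNReal.ofReal r) P) (hZ0 : ∀ i, ∫ ω, Z i ω ∂P = 0)
    (hκ : ∀ i, lpNorm (Z i) (ENNReal.ofReal r) P ≤ κ) (c : ι → ℝ) :
    lpNorm (fun ω => ∑ i, c i * Z i ω) (ENNReal.ofReal r) P ^ 2 ≤
      mzConst r * κ ^ 2 * ∑ i, c i ^ 2 := by
  have hfun : (fun ω => ∑ i, c i * Z i ω) = ∑ i, c i • Z i := by
    ext ω; simp
  have hterm : ∀ i, lpNorm (c i • Z i) (ENNReal.ofReal r) P ^ 2 ≤ κ ^ 2 * c i ^ 2 := fun i => by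
    rw [lpNorm_const_smul, mul_pow, coe_nnnorm, Real.norm_eq_abs, sq_abs, mul_comm]
    gcongr
    exacts [lpNorm_nonneg, hκ i]
  calc lpNorm (fun ω => ∑ i, c i * Z i ω) (ENNReal.ofReal r) P ^ 2
      ≤ mzConst r * ∑ i, lpNorm (c i • Z i) (ENNReal.ofReal r) P ^ 2 := by
        rw [hfun]
        exact lpNorm_sum_sq_le hr
          (hind.comp (fun i x => c i * x) fun i => measurable_const_mul (c i))
          (fun i => (hZ i).const_smul (c i)) (fun i => by simp [integral_const_mul, hZ0]) _
    _ ≤ mzConst r * ∑ i, κ ^ 2 * c i ^ 2 :=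
        mul_le_mul_of_nonneg_left (Finset.sum_le_sum fun i _ => hterm i)
          (mzConst_nonneg (by linarith))
    _ = mzConst r * κ ^ 2 * ∑ i, c i ^ 2 := by rw [← Finset.mul_sum, mul_assoc]

lemma integral_sum_mul_sq (hind : iIndepFun Z P) (hZ : ∀ i, MemLp (Z i) 2 P)
    (hZ0 : ∀ i, ∫ ω, Z i ω ∂P = 0) (c : ι → ℝ) :
    ∫ ω, (∑ i, c i * Z i ω) ^ 2 ∂P = ∑ i, c i ^ 2 * Var[Z i; P] := by
  have hfun : (fun ω => ∑ i, c i * Z i ω) = ∑ i, c i • Z i := by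
    ext ω; simp
  have hmem : ∀ i, MemLp (c i • Z i) 2 P := fun i => (hZ i).const_smul (c i)
  have hind' : iIndepFun (fun i => c i • Z i) P :=
    hind.comp (fun i x => c i * x) fun i => measurable_const_mul (c i)
  have hcentred : ∫ ω, ∑ i, c i * Z i ω ∂P = 0 := by
    rw [integral_finsetSum _ fun i _ => ((hZ i).integrable (by norm_num)).const_mul (c i)]
    simp [integral_const_mul, hZ0]
  have hmeas : AEMeasurable (fun ω => ∑ i, c i * Z i ω) P := by
    rw [hfun]; exact (memLp_finsetSum' _ fun i _ => hmem i).1.aemeasurable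
  calc ∫ ω, (∑ i, c i * Z i ω) ^ 2 ∂P = Var[fun ω => ∑ i, c i * Z i ω; P] :=
        (variance_of_integral_eq_zero hmeas hcentred).symm
    _ = ∑ i, Var[c i • Z i; P] := by
        rw [hfun]
        exact IndepFun.variance_sum (fun i _ => hmem i) fun i _ j _ hij => hind'.indepFun hij
    _ = ∑ i, c i ^ 2 * Var[Z i; P] := by simp only [variance_smul]

end LinearForms

section WhiteNoise

/-- White noise: independent standardised real random variables whose `L^r` norms are at most `κ`.
The laws of the variables need not coincide. -/
structure IsWhiteNoise {ι : Type*} (P : Measure Ω) (X : ι → Ω → ℝ) (r κ : ℝ) : Prop where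
  indep : iIndepFun X P
  memLp : ∀ i, MemLp (X i) (ENNReal.ofReal r) P
  integral_eq_zero : ∀ i, ∫ ω, X i ω ∂P = 0
  variance_eq_one : ∀ i, Var[X i; P] = 1
  lpNorm_le : ∀ i, lpNorm (X i) (ENNReal.ofReal r) P ≤ κ

lemma IsWhiteNoise.precomp {ι ι' : Type*} {X : ι → Ω → ℝ} {r κ : ℝ} (hX : IsWhiteNoise P X r κ)
    {g : ι' → ι} (hg : g.Injective) : IsWhiteNoise P (fun i => X (g i)) r κ where
  indep := hX.indep.precomp hg
  memLp i := hX.memLp (g i)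
  integral_eq_zero i := hX.integral_eq_zero (g i)
  variance_eq_one i := hX.variance_eq_one (g i)
  lpNorm_le i := hX.lpNorm_le (g i)

lemma IsStandardNoise.isWhiteNoise {n m p : ℕ} {E : Fin n → Ω → Matrix (Fin m) (Fin p) ℝ}
    (hE : IsStandardNoise P E) {r K : ℝ} (hr : 0 < r)
    (hint : ∀ k i j, Integrable (fun ω => |E k ω i j| ^ r) P)
    (hK : ∀ k i j, ∫ ω, |E k ω i j| ^ r ∂P ≤ K) :
    IsWhiteNoise P (fun (t : Fin n × Fin m × Fin p) ω => E t.1 ω t.2.1 t.2.2) r (K ^ r⁻¹) where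
  indep := hE.indep
  memLp t := (integrable_abs_rpow_iff hr (hE.measurable ..).aestronglyMeasurable).1 (hint ..)
  integral_eq_zero t := hE.mean ..
  variance_eq_one t := hE.variance ..
  lpNorm_le t := by
    have h := hK t.1 t.2.1 t.2.2
    rw [integral_abs_rpow_eq_lpNorm_rpow hr (hE.measurable ..).aestronglyMeasurable] at h
    exact (Real.le_rpow_inv_iff_of_pos lpNorm_nonneg
      ((Real.rpow_nonneg lpNorm_nonneg r).trans h) hr).2 h

end WhiteNoise

section Trace

variable {α β γ : Type*} [Fintype α] [Fintype β] [Fintype γ]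

lemma trace_mul_transpose_eq_sum (A B : Matrix α β ℝ) :
    (A * B.transpose).trace = ∑ t : α × β, A t.1 t.2 * B t.1 t.2 := by
  simp [Matrix.trace, Matrix.mul_apply, Fintype.sum_prod_type]

lemma trace_mul_transpose_self_eq_sum (A : Matrix α β ℝ) :
    (A * A.transpose).trace = ∑ t : α × β, A t.1 t.2 ^ 2 := by
  simp only [trace_mul_transpose_eq_sum, sq]

lemma trace_mul_transpose_self_nonneg (A : Matrix α β ℝ) : 0 ≤ (A * A.transpose).trace := by
  rw [trace_mul_transpose_self_eq_sum]; positivity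

lemma trace_mul_mul_transpose_le (A : Matrix α β ℝ) (B : Matrix β γ ℝ) :
    ((A * B) * (A * B).transpose).trace ≤
      (A * A.transpose).trace * (B * B.transpose).trace := by
  have hcauchy : ∀ i k, (A * B) i k ^ 2 ≤ (∑ j, A i j ^ 2) * ∑ j, B j k ^ 2 := fun i k => by
    rw [Matrix.mul_apply]
    exact Finset.sum_mul_sq_le_sq_mul_sq Finset.univ (A i) fun j => B j k
  simp only [trace_mul_transpose_self_eq_sum, Fintype.sum_prod_type]
  rw [Finset.sum_comm (f := fun j k => B j k ^ 2), Finset.sum_mul_sum]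
  exact Finset.sum_le_sum fun i _ => Finset.sum_le_sum fun k _ => hcauchy i k

lemma trace_mul_mul_transpose_eq_sum (G : Matrix γ α ℝ) (X : Matrix α β ℝ) (M : Matrix γ β ℝ) :
    (G * X * M.transpose).trace =
      ∑ t : α × β, (G.transpose * M) t.1 t.2 * X t.1 t.2 := by
  have hcycle : (G * X * M.transpose).trace = (G.transpose * M * X.transpose).trace := by
    rw [← Matrix.trace_transpose, Matrix.transpose_mul, Matrix.transpose_mul,
      Matrix.transpose_transpose, ← Matrix.mul_assoc, Matrix.trace_mul_comm, ← Matrix.mul_assoc]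
  rw [hcycle, trace_mul_transpose_eq_sum]

lemma trace_add_mul_add_transpose (A B : Matrix α β ℝ) :
    ((A + B) * (A + B).transpose).trace = (A * A.transpose).trace +
      2 * (B * A.transpose).trace + (B * B.transpose).trace := by
  have hcross : (A * B.transpose).trace = (B * A.transpose).trace := by
    rw [← Matrix.trace_transpose, Matrix.transpose_mul, Matrix.transpose_transpose]
  simp only [Matrix.transpose_add, Matrix.add_mul, Matrix.mul_add, Matrix.trace_add, hcross]
  ring

end Trace

section MatrixNoise

variable {α β γ : Type*} {r κ : ℝ} {x : α → Ω → ℝ} {X : Ω → Matrix α β ℝ}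

lemma IsWhiteNoise.column (hX : IsWhiteNoise P (fun (t : α × β) ω => X ω t.1 t.2) r κ) (j : β) :
    IsWhiteNoise P (fun i ω => X ω i j) r κ :=
  hX.precomp (Prod.mk_left_injective j)

variable [Fintype α] [Fintype γ]

/-- The squared Euclidean length of `G v`. Applied to the columns `v` of a noise matrix `X` it
breaks `tr (G X (G X)ᵀ)` into independent summands. -/
def sqNormMulVec (G : Matrix γ α ℝ) (v : α → ℝ) : ℝ :=
  ∑ l, (∑ i, G l i * v i) ^ 2

lemma measurable_sqNormMulVec (G : Matrix γ α ℝ) : Measurable (sqNormMulVec G) := by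
  unfold sqNormMulVec; fun_prop

lemma IsWhiteNoise.memLp_sqNormMulVec (hr : 0 ≤ r) (hx : IsWhiteNoise P x r κ)
    (G : Matrix γ α ℝ) :
    MemLp (fun ω => sqNormMulVec G fun i => x i ω) (ENNReal.ofReal (r / 2)) P :=
  memLp_finsetSum _ fun l _ =>
    memLp_sq hr (memLp_finsetSum _ fun i _ => (hx.memLp i).const_mul (G l i))

lemma IsWhiteNoise.iIndepFun_sqNormMulVec [Countable β]
    (hX : IsWhiteNoise P (fun (t : α × β) ω => X ω t.1 t.2) r κ) (G : Matrix γ α ℝ) :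
    iIndepFun (fun j ω => sqNormMulVec G fun i => X ω i j) P :=
  (iIndepFun_curry (X := fun (t : β × α) ω => X ω t.2 t.1)
    (fun t => (hX.memLp (t.2, t.1)).1.aemeasurable)
    (hX.indep.precomp Prod.swap_injective)).comp (fun _ => sqNormMulVec G)
    fun _ => measurable_sqNormMulVec G

variable [Fintype β]

lemma IsWhiteNoise.memLp_trace_mul
    (hX : IsWhiteNoise P (fun (t : α × β) ω => X ω t.1 t.2) r κ)
    (G : Matrix γ α ℝ) (M : Matrix γ β ℝ) :
    MemLp (fun ω => (G * X ω * M.transpose).trace) (ENNReal.ofReal r) P := by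
  simp only [trace_mul_mul_transpose_eq_sum]
  exact memLp_finsetSum _ fun t _ => (hX.memLp t).const_mul _

lemma trace_mul_mul_mul_transpose_eq_sum_sqNormMulVec (G : Matrix γ α ℝ) (X : Matrix α β ℝ) :
    ((G * X) * (G * X).transpose).trace = ∑ j, sqNormMulVec G fun i => X i j := by
  simp only [trace_mul_transpose_self_eq_sum, Fintype.sum_prod_type, sqNormMulVec,
    Matrix.mul_apply]
  exact Finset.sum_comm

variable [IsProbabilityMeasure P]

lemma IsWhiteNoise.lpNorm_trace_mul_sq_le (hr : 2 ≤ r)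
    (hX : IsWhiteNoise P (fun (t : α × β) ω => X ω t.1 t.2) r κ)
    (G : Matrix γ α ℝ) (M : Matrix γ β ℝ) :
    lpNorm (fun ω => (G * X ω * M.transpose).trace) (ENNReal.ofReal r) P ^ 2 ≤
      mzConst r * κ ^ 2 * ((G * G.transpose).trace * (M * M.transpose).trace) := by
  have hC : 0 ≤ mzConst r * κ ^ 2 := mul_nonneg (mzConst_nonneg (by linarith)) (sq_nonneg κ)
  have hcoeff : ∑ t : α × β, (G.transpose * M) t.1 t.2 ^ 2 ≤
      (G * G.transpose).trace * (M * M.transpose).trace := by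
    rw [← trace_mul_transpose_self_eq_sum, G.trace_mul_comm]
    simpa only [Matrix.transpose_transpose] using trace_mul_mul_transpose_le G.transpose M
  simp only [trace_mul_mul_transpose_eq_sum]
  exact (lpNorm_sum_mul_sq_le hr hX.indep hX.memLp hX.integral_eq_zero hX.lpNorm_le _).trans
    (mul_le_mul_of_nonneg_left hcoeff hC)

lemma IsWhiteNoise.integral_sqNormMulVec (hr : 2 ≤ r) (hx : IsWhiteNoise P x r κ)
    (G : Matrix γ α ℝ) :
    ∫ ω, sqNormMulVec G (fun i => x i ω) ∂P = (G * G.transpose).trace := by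
  have hx2 : ∀ i, MemLp (x i) 2 P := fun i =>
    (hx.memLp i).mono_exponent (by simpa using ENNReal.ofReal_le_ofReal hr)
  have hint : ∀ l, Integrable (fun ω => (∑ i, G l i * x i ω) ^ 2) P := fun l =>
    (memLp_finsetSum _ fun i _ => (hx2 i).const_mul (G l i)).integrable_sq
  simp only [sqNormMulVec]
  rw [integral_finsetSum _ fun l _ => hint l, trace_mul_transpose_self_eq_sum,
    Fintype.sum_prod_type]
  simp only [integral_sum_mul_sq hx.indep hx2 hx.integral_eq_zero, hx.variance_eq_one, mul_one]

lemma IsWhiteNoise.lpNorm_sqNormMulVec_le (hr : 2 ≤ r) (hx : IsWhiteNoise P x r κ)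
    (G : Matrix γ α ℝ) :
    lpNorm (fun ω => sqNormMulVec G fun i => x i ω) (ENNReal.ofReal (r / 2)) P ≤
      mzConst r * κ ^ 2 * (G * G.transpose).trace := by
  have hr0 : 0 ≤ r := by linarith
  have hmem : ∀ l, MemLp (fun ω => ∑ i, G l i * x i ω) (ENNReal.ofReal r) P := fun l =>
    memLp_finsetSum _ fun i _ => (hx.memLp i).const_mul (G l i)
  have hfun : (fun ω => sqNormMulVec G fun i => x i ω) =
      ∑ l, fun ω => (∑ i, G l i * x i ω) ^ 2 := by
    ext ω; simp [sqNormMulVec]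
  calc lpNorm (fun ω => sqNormMulVec G fun i => x i ω) (ENNReal.ofReal (r / 2)) P
      ≤ ∑ l, lpNorm (fun ω => (∑ i, G l i * x i ω) ^ 2) (ENNReal.ofReal (r / 2)) P := by
        rw [hfun]
        exact lpNorm_sum_le (fun l _ => memLp_sq hr0 (hmem l))
          (by rw [← ENNReal.ofReal_one]; exact ENNReal.ofReal_le_ofReal (by linarith))
    _ = ∑ l, lpNorm (fun ω => ∑ i, G l i * x i ω) (ENNReal.ofReal r) P ^ 2 :=
        Finset.sum_congr rfl fun l _ => lpNorm_sq hr0 (hmem l).1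
    _ ≤ ∑ l, mzConst r * κ ^ 2 * ∑ i, G l i ^ 2 :=
        Finset.sum_le_sum fun l _ =>
          lpNorm_sum_mul_sq_le hr hx.indep hx.memLp hx.integral_eq_zero hx.lpNorm_le (G l)
    _ = mzConst r * κ ^ 2 * (G * G.transpose).trace := by
        rw [← Finset.mul_sum, trace_mul_transpose_self_eq_sum, Fintype.sum_prod_type]

lemma IsWhiteNoise.lpNorm_sqNormMulVec_sub_le (hr : 2 ≤ r) (hx : IsWhiteNoise P x r κ)
    (G : Matrix γ α ℝ) :
    lpNorm (fun ω => (sqNormMulVec G fun i => x i ω) - (G * G.transpose).trace)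
        (ENNReal.ofReal (r / 2)) P ≤
      2 * mzConst r * κ ^ 2 * (G * G.transpose).trace := by
  have hq : 1 ≤ ENNReal.ofReal (r / 2) := by
    rw [← ENNReal.ofReal_one]; exact ENNReal.ofReal_le_ofReal (by linarith)
  have hcentre := lpNorm_sub_integral_le hq (hx.memLp_sqNormMulVec (by linarith) G)
  rw [hx.integral_sqNormMulVec hr G] at hcentre
  linarith [hx.lpNorm_sqNormMulVec_le hr G]

lemma IsWhiteNoise.memLp_trace_mul_mul_transpose_sub (hr : 0 ≤ r)
    (hX : IsWhiteNoise P (fun (t : α × β) ω => X ω t.1 t.2) r κ) (G : Matrix γ α ℝ) (a : ℝ) :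
    MemLp (fun ω => ((G * X ω) * (G * X ω).transpose).trace - a) (ENNReal.ofReal (r / 2)) P := by
  simp only [trace_mul_mul_mul_transpose_eq_sum_sqNormMulVec]
  exact (memLp_finsetSum _ fun j _ => (hX.column j).memLp_sqNormMulVec hr G).sub (memLp_const a)

lemma IsWhiteNoise.lpNorm_trace_mul_mul_transpose_sub_sq_le (hr : 4 ≤ r)
    (hX : IsWhiteNoise P (fun (t : α × β) ω => X ω t.1 t.2) r κ) (G : Matrix γ α ℝ) :
    lpNorm (fun ω => ((G * X ω) * (G * X ω).transpose).trace -
        Fintype.card β * (G * G.transpose).trace) (ENNReal.ofReal (r / 2)) P ^ 2 ≤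
      mzConst (r / 2) * (2 * mzConst r * κ ^ 2) ^ 2 *
        (Fintype.card β * (G * G.transpose).trace ^ 2) := by
  set g := (G * G.transpose).trace
  let Y : β → Ω → ℝ := fun j ω => (sqNormMulVec G fun i => X ω i j) - g
  have hfun : (fun ω => ((G * X ω) * (G * X ω).transpose).trace - Fintype.card β * g) =
      ∑ j, Y j := by
    ext ω
    rw [trace_mul_mul_mul_transpose_eq_sum_sqNormMulVec]
    simp [Y]
  have hmem : ∀ j, MemLp (fun ω => sqNormMulVec G fun i => X ω i j) (ENNReal.ofReal (r / 2)) P :=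
    fun j => (hX.column j).memLp_sqNormMulVec (by linarith) G
  have hq : 1 ≤ ENNReal.ofReal (r / 2) := by
    rw [← ENNReal.ofReal_one]; exact ENNReal.ofReal_le_ofReal (by linarith)
  have hY0 : ∀ j, ∫ ω, Y j ω ∂P = 0 := fun j => by
    rw [integral_sub ((hmem j).integrable hq) (integrable_const g),
      (hX.column j).integral_sqNormMulVec (by linarith) G]
    simp [g]
  have hY : ∀ j, lpNorm (Y j) (ENNReal.ofReal (r / 2)) P ≤ 2 * mzConst r * κ ^ 2 * g := fun j =>
    (hX.column j).lpNorm_sqNormMulVec_sub_le (by linarith) G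
  calc _ ≤ mzConst (r / 2) * ∑ j, lpNorm (Y j) (ENNReal.ofReal (r / 2)) P ^ 2 := by
        rw [hfun]
        exact lpNorm_sum_sq_le (by linarith) ((hX.iIndepFun_sqNormMulVec G).comp (fun _ y => y - g)
            fun _ => measurable_id.sub_const g)
          (fun j => (hmem j).sub (memLp_const g)) hY0 _
    _ ≤ mzConst (r / 2) * ∑ _j : β, (2 * mzConst r * κ ^ 2 * g) ^ 2 :=
        mul_le_mul_of_nonneg_left
          (Finset.sum_le_sum fun j _ => pow_le_pow_left₀ lpNorm_nonneg (hY j) 2)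
          (mzConst_nonneg (by linarith))
    _ = _ := by
        rw [Finset.sum_const, Finset.card_univ, nsmul_eq_mul]; ring

end MatrixNoise

section Stacking

open scoped MatrixOrder in
lemma matSqrt_mul_transpose_self {m : ℕ} {S : Matrix (Fin m) (Fin m) ℝ} (hS : S.PosSemidef) :
    matSqrt S * (matSqrt S).transpose = S := by
  have hsymm : (matSqrt S).transpose = matSqrt S :=
    (Matrix.nonneg_iff_posSemidef.1 (CFC.sqrt_nonneg S)).isHermitian
  rw [hsymm]
  exact CFC.sqrt_mul_sqrt_self S hS.nonneg

/-- The row `n⁻¹ (S^(1/2), …, S^(1/2))` of `n` blocks. Multiplied by the noise matrices stacked on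
top of each other, it gives the noise of the sample mean. -/
noncomputable def averagingFactor {m : ℕ} (n : ℕ) (S : Matrix (Fin m) (Fin m) ℝ) :
    Matrix (Fin m) (Fin n × Fin m) ℝ :=
  Matrix.of fun l t => matSqrt S l t.2 / n

/-- The noise matrices `E 0, …, E (n - 1)` stacked on top of each other. -/
def stack {n m p : ℕ} (E : Fin n → Matrix (Fin m) (Fin p) ℝ) :
    Matrix (Fin n × Fin m) (Fin p) ℝ :=
  Matrix.of fun t j => E t.1 t.2 j

lemma sampleMean_eq_add_averagingFactor_mul_stack {n m p : ℕ} (hn : n ≠ 0)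
    (A : Matrix (Fin m) (Fin p) ℝ) (S : Matrix (Fin m) (Fin m) ℝ)
    (E : Fin n → Matrix (Fin m) (Fin p) ℝ) :
    sampleMean A S E = A + averagingFactor n S * stack E := by
  have hnoise : averagingFactor n S * stack E = (1 / (n : ℝ)) • ∑ k, matSqrt S * E k := by
    ext l j
    simp only [averagingFactor, stack, Matrix.mul_apply, Matrix.of_apply, Matrix.smul_apply,
      Matrix.sum_apply, smul_eq_mul, Fintype.sum_prod_type, Finset.mul_sum]
    exact Finset.sum_congr rfl fun k _ => Finset.sum_congr rfl fun i _ => by ring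
  have hconst : (1 / (n : ℝ)) • ∑ _k : Fin n, A = A := by
    rw [Finset.sum_const, Finset.card_univ, Fintype.card_fin, ← Nat.cast_smul_eq_nsmul ℝ,
      smul_smul, one_div_mul_cancel (Nat.cast_ne_zero.2 hn), one_smul]
  simp only [sampleMean, observation, Finset.sum_add_distrib, smul_add]
  rw [hconst, hnoise]

lemma trace_averagingFactor_mul_transpose {n m : ℕ} (hn : n ≠ 0)
    {S : Matrix (Fin m) (Fin m) ℝ} (hS : S.PosSemidef) :
    (averagingFactor n S * (averagingFactor n S).transpose).trace = S.trace / n := by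
  have hn' : (n : ℝ) ≠ 0 := Nat.cast_ne_zero.2 hn
  have hsqrt : S.trace = ∑ l, ∑ i, matSqrt S l i ^ 2 := by
    conv_lhs => rw [← matSqrt_mul_transpose_self hS]
    rw [trace_mul_transpose_self_eq_sum, Fintype.sum_prod_type]
  simp only [trace_mul_transpose_self_eq_sum, averagingFactor, Matrix.of_apply,
    Fintype.sum_prod_type, Finset.sum_const, Finset.card_univ, Fintype.card_fin, nsmul_eq_mul,
    div_pow, hsqrt, ← Finset.sum_div, ← Finset.mul_sum]
  field_simp

lemma IsWhiteNoise.stack {n m p : ℕ} {E : Fin n → Ω → Matrix (Fin m) (Fin p) ℝ} {r κ : ℝ}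
    (hE : IsWhiteNoise P (fun (t : Fin n × Fin m × Fin p) ω => E t.1 ω t.2.1 t.2.2) r κ) :
    IsWhiteNoise P (fun (t : (Fin n × Fin m) × Fin p) ω =>
      ColumnCorrelated.stack (fun k => E k ω) t.1 t.2) r κ :=
  hE.precomp (Equiv.prodAssoc (Fin n) (Fin m) (Fin p)).injective

lemma trace_allOnes_div_le (m p : ℕ) :
    (allOnes m p * (allOnes m p).transpose).trace / (m * p) ≤ 1 := by
  have htrace : (allOnes m p * (allOnes m p).transpose).trace = m * p := by
    simp [trace_mul_transpose_self_eq_sum, allOnes]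
  rw [htrace]
  exact div_self_le_one _

end Stacking

section Limits

lemma lpNorm_div_const_sq (X : Ω → ℝ) (a : ℝ) (q : ENNReal) :
    lpNorm (fun ω => X ω / a) q P ^ 2 = lpNorm X q P ^ 2 / a ^ 2 := by
  have hsmul : (fun ω => X ω / a) = a⁻¹ • X := by
    ext ω; simp [div_eq_inv_mul]
  rw [hsmul, lpNorm_const_smul, mul_pow, coe_nnnorm, Real.norm_eq_abs, sq_abs, inv_pow,
    div_eq_inv_mul]

lemma isBigO_inv_natCast {p : ℕ → ℕ}
    (hmp : (fun m : ℕ => (m : ℝ)) =O[atTop] fun m => (p m : ℝ)) :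
    (fun m => (p m : ℝ)⁻¹) =O[atTop] fun m : ℕ => (m : ℝ)⁻¹ :=
  hmp.inv_rev <| (eventually_ne_atTop 0).mono fun _ hm h => absurd (Nat.cast_eq_zero.1 h) hm

lemma asympDetEquiv_iff {Y : ℕ → Ω → ℝ} {y : ℕ → ℝ} :
    AsympDetEquiv P Y y ↔ ∀ᵐ ω ∂P, Tendsto (fun m => Y m ω - y m) atTop (𝓝 0) :=
  eventually_congr (.of_forall fun _ => (tendsto_zero_iff_abs_tendsto_zero _).symm)

variable [IsProbabilityMeasure P] {p : ℕ → ℕ} {α : ℕ → Type*} [∀ m, Fintype (α m)]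
  {X : (m : ℕ) → Ω → Matrix (α m) (Fin (p m)) ℝ} {G : (m : ℕ) → Matrix (Fin m) (α m) ℝ}
  {r κ C : ℝ}

lemma ae_tendsto_trace_mul_div (hr : 2 < r)
    (hmp : (fun m : ℕ => (m : ℝ)) =O[atTop] fun m => (p m : ℝ))
    (hX : ∀ m, IsWhiteNoise P (fun (t : α m × Fin (p m)) ω => X m ω t.1 t.2) r κ)
    (hG : ∀ m : ℕ, (G m * (G m).transpose).trace / m ≤ C)
    {M : (m : ℕ) → Matrix (Fin m) (Fin (p m)) ℝ} {D : ℝ}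
    (hM : ∀ m : ℕ, (M m * (M m).transpose).trace / (m * p m) ≤ D) :
    ∀ᵐ ω ∂P, Tendsto (fun m : ℕ => (G m * X m ω * (M m).transpose).trace / (m * p m))
      atTop (𝓝 0) := by
  refine ae_tendsto_zero_of_isBigO_lpNorm_sq hr
    (fun m => by
      simpa only [div_eq_mul_inv] using ((hX m).memLp_trace_mul (G m) (M m)).mul_const _)
    ((Asymptotics.IsBigO.of_bound (mzConst r * κ ^ 2 * (C * D)) <| .of_forall fun m => ?_).trans
      (isBigO_inv_natCast hmp))
  have hg : 0 ≤ (G m * (G m).transpose).trace / m :=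
    div_nonneg (trace_mul_transpose_self_nonneg _) m.cast_nonneg
  have hM0 : 0 ≤ (M m * (M m).transpose).trace / (m * p m) :=
    div_nonneg (trace_mul_transpose_self_nonneg _) (by positivity)
  have hmz : 0 ≤ mzConst r * κ ^ 2 := mul_nonneg (mzConst_nonneg (by linarith)) (sq_nonneg κ)
  rw [Real.norm_of_nonneg (by positivity), Real.norm_of_nonneg (by positivity),
    lpNorm_div_const_sq]
  calc _ ≤ mzConst r * κ ^ 2 * ((G m * (G m).transpose).trace * (M m * (M m).transpose).trace) /
        (m * p m) ^ 2 := by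
        gcongr; exact (hX m).lpNorm_trace_mul_sq_le hr.le (G m) (M m)
    _ = mzConst r * κ ^ 2 * ((G m * (G m).transpose).trace / m *
        ((M m * (M m).transpose).trace / (m * p m))) * (p m : ℝ)⁻¹ := by ring
    _ ≤ mzConst r * κ ^ 2 * (C * D) * (p m : ℝ)⁻¹ := by
        gcongr
        exacts [hg.trans (hG m), hG m, hM m]

lemma ae_tendsto_trace_mul_mul_transpose_sub_div (hr : 4 < r)
    (hmp : (fun m : ℕ => (m : ℝ)) =O[atTop] fun m => (p m : ℝ))
    (hX : ∀ m, IsWhiteNoise P (fun (t : α m × Fin (p m)) ω => X m ω t.1 t.2) r κ)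
    (hG : ∀ m : ℕ, (G m * (G m).transpose).trace / m ≤ C) :
    ∀ᵐ ω ∂P, Tendsto (fun m : ℕ => (((G m * X m ω) * (G m * X m ω).transpose).trace -
      p m * (G m * (G m).transpose).trace) / (m * p m)) atTop (𝓝 0) := by
  refine ae_tendsto_zero_of_isBigO_lpNorm_sq (r := r / 2) (by linarith)
    (fun m => by
      simpa only [div_eq_mul_inv] using
        ((hX m).memLp_trace_mul_mul_transpose_sub (by linarith) (G m) _).mul_const _)
    ((Asymptotics.IsBigO.of_bound (mzConst (r / 2) * (2 * mzConst r * κ ^ 2) ^ 2 * C ^ 2) <|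
      .of_forall fun m => ?_).trans (isBigO_inv_natCast hmp))
  have hg : 0 ≤ (G m * (G m).transpose).trace / m :=
    div_nonneg (trace_mul_transpose_self_nonneg _) m.cast_nonneg
  have hmz : 0 ≤ mzConst (r / 2) := mzConst_nonneg (by linarith)
  have hbound := (hX m).lpNorm_trace_mul_mul_transpose_sub_sq_le hr.le (G m)
  rw [Fintype.card_fin] at hbound
  rw [Real.norm_of_nonneg (by positivity), Real.norm_of_nonneg (by positivity),
    lpNorm_div_const_sq]
  calc _ ≤ mzConst (r / 2) * (2 * mzConst r * κ ^ 2) ^ 2 *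
        (p m * (G m * (G m).transpose).trace ^ 2) / (m * p m) ^ 2 := by gcongr
    _ = mzConst (r / 2) * (2 * mzConst r * κ ^ 2) ^ 2 *
        ((G m * (G m).transpose).trace / m) ^ 2 * (p m / (p m * p m)) := by ring
    _ = mzConst (r / 2) * (2 * mzConst r * κ ^ 2) ^ 2 *
        ((G m * (G m).transpose).trace / m) ^ 2 * (p m : ℝ)⁻¹ := by rw [div_self_mul_self']
    _ ≤ mzConst (r / 2) * (2 * mzConst r * κ ^ 2) ^ 2 * C ^ 2 * (p m : ℝ)⁻¹ := by
        gcongr; exact hG m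

lemma ae_tendsto_trace_mul_mul_transpose_div_sub (hr : 4 < r)
    (hmp : (fun m : ℕ => (m : ℝ)) =O[atTop] fun m => (p m : ℝ))
    (hX : ∀ m, IsWhiteNoise P (fun (t : α m × Fin (p m)) ω => X m ω t.1 t.2) r κ)
    (hG : ∀ m : ℕ, (G m * (G m).transpose).trace / m ≤ C) :
    ∀ᵐ ω ∂P, Tendsto (fun m : ℕ => ((G m * X m ω) * (G m * X m ω).transpose).trace / (m * p m) -
      (G m * (G m).transpose).trace / m) atTop (𝓝 0) := by
  filter_upwards [ae_tendsto_trace_mul_mul_transpose_sub_div hr hmp hX hG] with ω hω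
  refine hω.congr' ?_
  filter_upwards [hmp.eq_zero_imp, eventually_ne_atTop 0] with m hzero hm
  have hp : (p m : ℝ) ≠ 0 := fun h => hm (Nat.cast_eq_zero.1 (hzero h))
  field_simp

end Limits

end ColumnCorrelated

theorem theorem3_general {Ω : Type*} [MeasurableSpace Ω] (P : Measure Ω) [IsProbabilityMeasure P]
    {n : ℕ} (hn : n ≠ 0) (p : ℕ → ℕ)
    (hmp : (fun m : ℕ => (m : ℝ)) =O[atTop] fun m => (p m : ℝ))
    (A : (m : ℕ) → Matrix (Fin m) (Fin (p m)) ℝ)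
    (hA_bdd : ∃ C : ℝ, ∀ m : ℕ,
      Matrix.trace (A m * (A m).transpose) / ((m : ℝ) * (p m : ℝ)) ≤ C)
    (S : (m : ℕ) → Matrix (Fin m) (Fin m) ℝ)
    (hS : ∀ m, (S m).PosSemidef)
    (hS_bdd : ∃ C : ℝ, ∀ m : ℕ, Matrix.trace (S m) / (m : ℝ) ≤ C)
    (E : (m : ℕ) → Fin n → Ω → Matrix (Fin m) (Fin (p m)) ℝ) {r κ : ℝ} (hr : 4 < r)
    (hE : ∀ m, ColumnCorrelated.IsWhiteNoise P
      (fun (t : Fin n × Fin m × Fin (p m)) ω => E m t.1 ω t.2.1 t.2.2) r κ) :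
    ColumnCorrelated.AsympDetEquiv P
      (fun m ω => Matrix.trace (ColumnCorrelated.sampleMean (A m) (S m) (fun k => E m k ω) *
        (ColumnCorrelated.allOnes m (p m)).transpose) / ((m : ℝ) * (p m : ℝ)))
      (fun m => Matrix.trace (A m * (ColumnCorrelated.allOnes m (p m)).transpose) /
        ((m : ℝ) * (p m : ℝ))) ∧
    ColumnCorrelated.AsympDetEquiv P
      (fun m ω => Matrix.trace (ColumnCorrelated.sampleMean (A m) (S m) (fun k => E m k ω) *
        (A m).transpose) / ((m : ℝ) * (p m : ℝ)))
      (fun m => Matrix.trace (A m * (A m).transpose) / ((m : ℝ) * (p m : ℝ))) ∧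
    ColumnCorrelated.AsympDetEquiv P
      (fun m ω => Matrix.trace (ColumnCorrelated.sampleMean (A m) (S m) (fun k => E m k ω) *
        (ColumnCorrelated.sampleMean (A m) (S m) (fun k => E m k ω)).transpose) /
        ((m : ℝ) * (p m : ℝ)))
      (fun m => Matrix.trace (A m * (A m).transpose) / ((m : ℝ) * (p m : ℝ)) +
        Matrix.trace (S m) / ((n : ℝ) * (m : ℝ))) := by
  obtain ⟨D, hD⟩ := hA_bdd
  obtain ⟨C, hC⟩ := hS_bdd
  have hG : ∀ m, (ColumnCorrelated.averagingFactor n (S m) *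
      (ColumnCorrelated.averagingFactor n (S m)).transpose).trace / m ≤ C / n := fun m => by
    rw [ColumnCorrelated.trace_averagingFactor_mul_transpose hn (hS m), div_right_comm]
    gcongr
    exact hC m
  have hX := fun m => (hE m).stack
  have hU := ColumnCorrelated.ae_tendsto_trace_mul_div (by linarith) hmp hX hG
    fun m => ColumnCorrelated.trace_allOnes_div_le m (p m)
  have hA := ColumnCorrelated.ae_tendsto_trace_mul_div (by linarith) hmp hX hG hD
  have hQ := ColumnCorrelated.ae_tendsto_trace_mul_mul_transpose_div_sub hr hmp hX hG
  simp only [ColumnCorrelated.asympDetEquiv_iff,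
    ColumnCorrelated.sampleMean_eq_add_averagingFactor_mul_stack hn]
  refine ⟨?_, ?_, ?_⟩
  · simpa only [Matrix.add_mul, Matrix.trace_add, add_div, add_sub_cancel_left] using hU
  · simpa only [Matrix.add_mul, Matrix.trace_add, add_div, add_sub_cancel_left] using hA
  · filter_upwards [hA, hQ] with ω hAω hQω
    have hsum := (hAω.const_mul 2).add hQω
    rw [mul_zero, add_zero] at hsum
    refine hsum.congr fun m => ?_
    rw [ColumnCorrelated.trace_add_mul_add_transpose,
      ColumnCorrelated.trace_averagingFactor_mul_transpose hn (hS m), div_div]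
    ring

theorem theorem3 {Ω : Type*} [MeasurableSpace Ω] (P : Measure Ω) [IsProbabilityMeasure P]
    -- sample size, number of columns for each number `m` of rows, limiting ratio
    (n : ℕ) (hn : 2 ≤ n) (p : ℕ → ℕ) (c : ℝ) (hc : 0 < c)
    (hp : Tendsto p atTop atTop)
    (hmp : Tendsto (fun m : ℕ => (m : ℝ) / (p m : ℝ)) atTop (𝓝 c))
    -- the true matrices
    (A : (m : ℕ) → Matrix (Fin m) (Fin (p m)) ℝ)
    (hA_nonneg : ∀ m i j, 0 ≤ A m i j)
    (hA_bdd : ∃ C : ℝ, ∀ m : ℕ,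
      Matrix.trace (A m * (A m).transpose) / ((m : ℝ) * (p m : ℝ)) ≤ C)
    -- the column covariance matrices
    (S : (m : ℕ) → Matrix (Fin m) (Fin m) ℝ)
    (hS : ∀ m, (S m).PosSemidef)
    (hS_bdd : ∃ C : ℝ, ∀ m : ℕ, Matrix.trace (S m) / (m : ℝ) ≤ C)
    -- the noise matrices, with moments of order `4 + ε` bounded uniformly in `m`
    (E : (m : ℕ) → Fin n → Ω → Matrix (Fin m) (Fin (p m)) ℝ)
    (hE : ∀ m, ColumnCorrelated.IsStandardNoise P (E m))
    (ε : ℝ) (hε : 0 < ε)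
    (hE_int : ∀ m k i j, Integrable (fun ω => |E m k ω i j| ^ (4 + ε)) P)
    (hE_bdd : ∃ K : ℝ, ∀ m k i j, ∫ ω, |E m k ω i j| ^ (4 + ε) ∂P ≤ K) :
    ColumnCorrelated.AsympDetEquiv P
      (fun m ω => Matrix.trace (ColumnCorrelated.sampleMean (A m) (S m) (fun k => E m k ω) *
        (ColumnCorrelated.allOnes m (p m)).transpose) / ((m : ℝ) * (p m : ℝ)))
      (fun m => Matrix.trace (A m * (ColumnCorrelated.allOnes m (p m)).transpose) /
        ((m : ℝ) * (p m : ℝ))) ∧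
    ColumnCorrelated.AsympDetEquiv P
      (fun m ω => Matrix.trace (ColumnCorrelated.sampleMean (A m) (S m) (fun k => E m k ω) *
        (A m).transpose) / ((m : ℝ) * (p m : ℝ)))
      (fun m => Matrix.trace (A m * (A m).transpose) / ((m : ℝ) * (p m : ℝ))) ∧
    ColumnCorrelated.AsympDetEquiv P
      (fun m ω => Matrix.trace (ColumnCorrelated.sampleMean (A m) (S m) (fun k => E m k ω) *
        (ColumnCorrelated.sampleMean (A m) (S m) (fun k => E m k ω)).transpose) /
        ((m : ℝ) * (p m : ℝ)))
      (fun m => Matrix.trace (A m * (A m).transpose) / ((m : ℝ) * (p m : ℝ)) +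
        Matrix.trace (S m) / ((n : ℝ) * (m : ℝ))) := by
  obtain ⟨K, hK⟩ := hE_bdd
  have hmO : (fun m : ℕ => (m : ℝ)) =O[atTop] fun m => (p m : ℝ) :=
    Asymptotics.isBigO_of_div_tendsto_nhds
      ((hp.eventually_ne_atTop 0).mono fun _ h h0 => absurd (Nat.cast_eq_zero.1 h0) h) c hmp
  exact theorem3_general P (by omega) p hmO A hA_bdd S hS hS_bdd E (by linarith) fun m =>
    (hE m).isWhiteNoise (by linarith) (hE_int m) (hK m)
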